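/- Let $d_1,d_2\ge 1$ and let $P,Q$ be Gaussian probability distributions (possibly degenerate) on $\mathbb{R}^{d_1}\times\mathbb{R}^{d_2}$, with points written $x=(x_1,x_2)$. Suppose that $P$ and $Q$ both have mean zero, that the marginal distribution of $x_1$ is the same under $P$ and $Q$, that the marginal distribution of $x_2$ is the same under $P$ and $Q$, and that $\mathbb{E}_P[x_1x_1^\top]=I_{d_1}$ and $\mathbb{E}_P[x_2x_2^\top]=I_{d_2}$. Let $\Sigma_P=\mathbb{E}_P[xx^\top]\in\mathbb{R}^{(d_1+d_2)\times(d_1+d_2)}$ and let $\lambda_{\min}(\Sigma_P)$ be its smallest eigenvalue. Let $$\mathcal{F}=\{\,x\mapsto f_1(x_1)+f_2(x_2)\;:\; f_i:\mathbb{R}^{d_i}\to\mathbb{R},\ \mathbb{E}_P[f_i(x_i)^2]<\infty \text{ for } i=1,2\,\}$$ (the $f_i$ being measurable with respect to the completed law of $x_i$), and define the $\mathcal{F}$-restricted error ratio $$\tau(P,Q,\mathcal{F})=\sup_{f,g\in\mathcal{F}}\frac{\mathbb{E}_Q[(f(x)-g(x))^2]}{\mathbb{E}_P[(f(x)-g(x))^2]}\in[0,\infty],$$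 with the conventions $0/0=0$ and $a/0=\infty$ for $a>0$. Then $$\tau(P,Q,\mathcal{F})\le\frac{2}{\lambda_{\min}(\Sigma_P)},$$ where the right-hand side is read as $\infty$ if $\lambda_{\min}(\Sigma_P)=0$. -/

import Mathlib

open MeasureTheory ProbabilityTheory
open scoped ENNReal

noncomputable section

/-- The matrix `E_μ[X Xᵀ]` of a random vector `X` with finitely many real coordinates. -/
def secondMomentMatrix {Ω ι : Type*} [MeasurableSpace Ω] (μ : Measure Ω) (X : Ω → ι → ℝ) :
    Matrix ι ι ℝ :=
  Matrix.of fun i j => ∫ ω, X ω i * X ω j ∂μ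

/-- The smallest eigenvalue of a (nonempty, symmetric) real matrix. -/
def lambdaMin {ι : Type*} [Fintype ι] [DecidableEq ι] (A : Matrix ι ι ℝ) : ℝ :=
  sInf (spectrum ℝ A)

/-- The coordinates of a point `x = (x₁, x₂)` of `ℝ^{d₁} × ℝ^{d₂}`, as one vector of length
`d₁ + d₂` indexed by the disjoint union of the two index sets. -/
def concatCoords {d₁ d₂ : ℕ} (x : EuclideanSpace ℝ (Fin d₁) × EuclideanSpace ℝ (Fin d₂)) :
    Fin d₁ ⊕ Fin d₂ → ℝ :=
  Sum.elim (fun i => x.1 i) (fun j => x.2 j)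

/-- The model class of all sums `f₁(x₁) + f₂(x₂)` with `E_P[f₁(x₁)²] < ∞` and
`E_P[f₂(x₂)²] < ∞`, the functions being measurable up to null sets of the marginals of `P`. -/
def additiveClass {X₁ X₂ : Type*} [MeasurableSpace X₁] [MeasurableSpace X₂]
    (P : Measure (X₁ × X₂)) : Set (X₁ × X₂ → ℝ) :=
  {f | ∃ (f₁ : X₁ → ℝ) (f₂ : X₂ → ℝ),
    MemLp f₁ 2 (P.map Prod.fst) ∧ MemLp f₂ 2 (P.map Prod.snd) ∧
      f = fun x => f₁ x.1 + f₂ x.2}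

/-- The restricted error ratio
`τ(P, Q, F) = sup_{f, g ∈ F} E_Q[(f - g)²] / E_P[(f - g)²]`, with values in `[0, ∞]`.
In `ℝ≥0∞` one has `0 / 0 = 0`, and `a / 0 = ∞` for `a ≠ 0`. -/
def restrictedErrorRatio {X : Type*} [MeasurableSpace X] (P Q : Measure X)
    (F : Set (X → ℝ)) : ℝ≥0∞ :=
  ⨆ f ∈ F, ⨆ g ∈ F,
    (∫⁻ x, ENNReal.ofReal ((f x - g x) ^ 2) ∂Q) / (∫⁻ x, ENNReal.ofReal ((f x - g x) ^ 2) ∂P)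

end

/-! Let c be the smallest eigenvalue, assumed positive, and let h = h₁(x₁) + h₂(x₂) be a difference
of two members of the class. Under Q, Var h ≤ 2 (Var h₁ + Var h₂), and the right side depends only
on the marginals, so it may be computed under P. It remains to show c (Var h₁ + Var h₂) ≤ Var h
under P; the means of h agree, and c ≤ 1 absorbs their square.

For linear h₁, h₂ this inequality is Σ_P ≥ c I, because the marginal covariances are identities.
Characters carry it to all of L² (`variance_add_ge_of_isGaussian`). Under a Gaussian law the
covariance of two characters is a rank-one factor times exp(cov) - 1. For finite sums of characters,
the claim thus follows once exp[A] - 1 - c (exp[B] - 1) is positive semidefinite, where A is the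
covariance matrix of the linear forms, B is its block-diagonal part, and exp acts entrywise.
Expanding exp reduces this to entrywise powers, which the Schur product theorem handles by induction
from A - c B ≥ 0. Density of the characters in L² finishes the argument. -/

/-! ### Entrywise powers and exponentials of positive semidefinite matrices -/

open scoped Matrix in
/-- If `B` arises from the positive semidefinite matrix `A` by deleting entries and `A - c • B` is
positive semidefinite, then so is the difference of the entrywise powers. -/
theorem posSemidef_map_pow_sub_smul {ι : Type*} {A B : Matrix ι ι ℝ} {c : ℝ}
    (hA : A.PosSemidef) (hB : ∀ k l, B k l = A k l ∨ B k l = 0)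
    (hAB : (A - c • B).PosSemidef) (n : ℕ) :
    (A.map (· ^ (n + 1)) - c • B.map (· ^ (n + 1))).PosSemidef := by
  induction n with
  | zero => simpa using hAB
  | succ n ih =>
    -- Wherever `B` is nonzero it equals `A`, so a Hadamard factor `A` raises the power of both
    -- terms.
    have h : A.map (· ^ (n + 1 + 1)) - c • B.map (· ^ (n + 1 + 1)) =
        (A.map (· ^ (n + 1)) - c • B.map (· ^ (n + 1))) ⊙ A := by
      ext k l
      rcases hB k l with h | h <;> simp [Matrix.sub_apply, h] <;> ring
    rw [h]
    exact ih.hadamard hA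

/-- The entrywise-exponential version of `posSemidef_map_pow_sub_smul`. -/
theorem posSemidef_map_exp_sub_smul {ι : Type*} [Fintype ι] {A B : Matrix ι ι ℝ} {c : ℝ}
    (hA : A.PosSemidef) (hB : ∀ k l, B k l = A k l ∨ B k l = 0)
    (hAB : (A - c • B).PosSemidef) :
    (A.map (fun t => Real.exp t - 1) - c • B.map (fun t => Real.exp t - 1)).PosSemidef := by
  have hpow := posSemidef_map_pow_sub_smul hA hB hAB
  -- The series starts at degree one: subtracting 1 keeps the zero entries of `B` zero.
  have hexp (t : ℝ) : HasSum (fun n : ℕ => (((n + 1).factorial : ℝ)⁻¹) * t ^ (n + 1))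
      (Real.exp t - 1) := by
    have h := NormedSpace.expSeries_div_hasSum_exp t
    rw [← Real.exp_eq_exp_ℝ] at h
    have h1 := (hasSum_nat_add_iff' 1).2 h
    simpa [div_eq_inv_mul] using h1
  have hsum (k l : ι) : HasSum
      (fun n : ℕ => (((n + 1).factorial : ℝ)⁻¹) *
        (A.map (· ^ (n + 1)) - c • B.map (· ^ (n + 1))) k l)
      ((A.map (fun t => Real.exp t - 1) - c • B.map (fun t => Real.exp t - 1)) k l) := by
    have h := (hexp (A k l)).sub ((hexp (B k l)).mul_left c)
    convert! h using 2 with n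
    simp [Matrix.sub_apply]
    ring
  refine Matrix.PosSemidef.of_dotProduct_mulVec_nonneg ?_ fun x => ?_
  · ext k l
    refine (hsum l k).unique ?_
    convert hsum k l using 2 with n
    exact congrArg _ ((hpow n).isHermitian.apply k l)
  · have h : HasSum (fun n : ℕ => (((n + 1).factorial : ℝ)⁻¹) *
        (star x ⬝ᵥ ((A.map (· ^ (n + 1)) - c • B.map (· ^ (n + 1))).mulVec x)))
        (star x ⬝ᵥ ((A.map (fun t => Real.exp t - 1) -
          c • B.map (fun t => Real.exp t - 1)).mulVec x)) := by
      simp only [dotProduct, Matrix.mulVec, Finset.mul_sum]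
      refine hasSum_sum fun k _ => hasSum_sum fun l _ => ?_
      have h := ((hsum k l).mul_right (x l)).mul_left (star x k)
      convert! h using 2 with n
      ring
    exact h.nonneg fun n => mul_nonneg (by positivity) ((hpow n).dotProduct_mulVec_nonneg x)

/-- For real symmetric `M` the real part splits into the quadratic forms of the real and imaginary
parts of `d`. -/
theorem Matrix.PosSemidef.re_sum_nonneg {ι : Type*} [Fintype ι] {M : Matrix ι ι ℝ}
    (hM : M.PosSemidef) (d : ι → ℂ) :
    0 ≤ (∑ k, ∑ l, starRingEnd ℂ (d k) * d l * (M k l : ℂ)).re := by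
  have h1 := hM.dotProduct_mulVec_nonneg fun k => (d k).re
  have h2 := hM.dotProduct_mulVec_nonneg fun k => (d k).im
  refine (add_nonneg h1 h2).trans_eq ?_
  simp only [dotProduct, Matrix.mulVec, Finset.mul_sum, Complex.re_sum]
  simp only [← Finset.sum_add_distrib]
  refine Finset.sum_congr rfl fun k _ => Finset.sum_congr rfl fun l _ => ?_
  simp
  ring

/-! ### Characters and their density in L² -/

/-- The character `x ↦ exp (i L x)` as an element of `L²`. -/
noncomputable def charLp {E : Type*} [NormedAddCommGroup E] [NormedSpace ℝ E]
    [SecondCountableTopology E] [MeasurableSpace E] [BorelSpace E]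
    (μ : Measure E) [IsFiniteMeasure μ] (L : StrongDual ℝ E) : Lp ℂ 2 μ :=
  BoundedContinuousFunction.toLp 2 μ ℂ (BoundedContinuousFunction.probCharDual L)

theorem coeFn_charLp {E : Type*} [NormedAddCommGroup E] [NormedSpace ℝ E]
    [SecondCountableTopology E] [MeasurableSpace E] [BorelSpace E]
    {μ : Measure E} [IsFiniteMeasure μ] (L : StrongDual ℝ E) :
    charLp μ L =ᵐ[μ] fun x => Complex.exp (L x * Complex.I) :=
  BoundedContinuousFunction.coeFn_toLp (p := 2) (μ := μ) ℂ
      (BoundedContinuousFunction.probCharDual L)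

/-- The bounded characters `x ↦ exp (i L x)` span a dense subspace of `L²`. -/
theorem span_charLp_topologicalClosure {E : Type*} [NormedAddCommGroup E] [NormedSpace ℝ E]
    [CompleteSpace E] [SecondCountableTopology E] [MeasurableSpace E] [BorelSpace E]
    (μ : Measure E) [IsFiniteMeasure μ] :
    (Submodule.span ℂ (Set.range (charLp μ))).topologicalClosure = ⊤ := by
  rw [Submodule.topologicalClosure_eq_top_iff, Submodule.eq_bot_iff]
  intro g hg
  have hgi : Integrable g μ := (Lp.memLp g).integrable (by norm_num)
  have horth (L : StrongDual ℝ E) : ∫ x, g x * Complex.exp (L x * Complex.I) ∂μ = 0 := by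
    have h := (Submodule.mem_orthogonal _ g).1 hg _ (Submodule.subset_span ⟨-L, rfl⟩)
    rw [L2.inner_def] at h
    rw [← h]
    refine integral_congr_ae ?_
    filter_upwards [coeFn_charLp (μ := μ) (-L)] with x hx
    rw [hx]
    simp [← Complex.exp_conj]
  have hchar (L : StrongDual ℝ E) : Integrable (fun x => Complex.exp (L x * Complex.I)) μ :=
    (BoundedContinuousFunction.probCharDual L).integrable μ
  have hnorm (L : StrongDual ℝ E) (x : E) : ‖Complex.exp (L x * Complex.I)‖ = 1 :=
    Complex.norm_exp_ofReal_mul_I _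
  -- A real `u` with vanishing Fourier transform has positive and negative parts that are densities
  -- of finite measures with equal characteristic functions, so the two parts agree a.e.
  -- `ENNReal.ofReal` performs the truncation.
  have hreal (u : E → ℝ) (hu : Integrable u μ)
      (h0 : ∀ L : StrongDual ℝ E, ∫ x, (u x : ℂ) * Complex.exp (L x * Complex.I) ∂μ = 0) :
      u =ᵐ[μ] 0 := by
    have hfin (v : E → ℝ) (hv : Integrable v μ) :
        IsFiniteMeasure (μ.withDensity fun x => ENNReal.ofReal (v x)) :=
      isFiniteMeasure_withDensity_ofReal hv.2
    have := hfin u hu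
    have := hfin _ hu.neg
    have hcf (v : E → ℝ) (hv : Integrable v μ) (L : StrongDual ℝ E) :
        charFunDual (μ.withDensity fun x => ENNReal.ofReal (v x)) L =
          ∫ x, ((max (v x) 0 : ℝ) : ℂ) * Complex.exp (L x * Complex.I) ∂μ := by
      rw [charFunDual_apply, integral_withDensity_eq_integral_toReal_smul₀
        (by fun_prop) (by simp)]
      simp [ENNReal.toReal_ofReal']
    have heq : (μ.withDensity fun x => ENNReal.ofReal (u x)) =
        μ.withDensity fun x => ENNReal.ofReal ((-u) x) := by
      refine Measure.ext_of_charFunDual ?_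
      ext L
      have hint (v : E → ℝ) (hv : Integrable v μ) : Integrable (fun x =>
          ((max (v x) 0 : ℝ) : ℂ) * Complex.exp (L x * Complex.I)) μ :=
        (Integrable.ofReal (𝕜 := ℂ) hv.pos_part).mul_bdd (c := 1) (hchar L).1
          (Filter.Eventually.of_forall fun x => (hnorm L x).le)
      rw [hcf u hu, hcf _ hu.neg, ← sub_eq_zero, ← integral_sub (hint u hu) (hint _ hu.neg), ← h0 L]
      refine integral_congr_ae (Filter.Eventually.of_forall fun x => ?_)
      simp only [Pi.neg_apply, ← sub_mul, ← Complex.ofReal_sub]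
      congr 2
      rcases le_total 0 (u x) with h | h <;> simp [h]
    rw [withDensity_eq_iff_of_sigmaFinite (by fun_prop) (by fun_prop)] at heq
    filter_upwards [heq] with x hx
    rcases le_total 0 (u x) with h | h
    · rw [Pi.neg_apply, ENNReal.ofReal_of_nonpos (by linarith : -u x ≤ 0),
        ENNReal.ofReal_eq_zero] at hx
      exact le_antisymm hx h
    · rw [Pi.neg_apply, ENNReal.ofReal_of_nonpos h, eq_comm, ENNReal.ofReal_eq_zero] at hx
      exact le_antisymm h (neg_nonpos.1 hx)
  have hconj (L : StrongDual ℝ E) :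
      ∫ x, starRingEnd ℂ (g x) * Complex.exp (L x * Complex.I) ∂μ = 0 := by
    rw [← map_zero (starRingEnd ℂ), ← horth (-L), ← integral_conj]
    simp [← Complex.exp_conj]
  have hmul (L : StrongDual ℝ E) : Integrable (fun x => g x * Complex.exp (L x * Complex.I)) μ :=
    hgi.mul_bdd (c := 1) (hchar L).1 (Filter.Eventually.of_forall fun x => (hnorm L x).le)
  have hmulc (L : StrongDual ℝ E) :
      Integrable (fun x => starRingEnd ℂ (g x) * Complex.exp (L x * Complex.I)) μ :=
    (Complex.conjLIE.toContinuousLinearEquiv.toContinuousLinearMap.integrable_comp hgi).mul_bdd (c := 1)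
      (hchar L).1 (Filter.Eventually.of_forall fun x => (hnorm L x).le)
  have hre := hreal (fun x => (g x).re) hgi.re fun L => by
    calc ∫ x, ((g x).re : ℂ) * Complex.exp (L x * Complex.I) ∂μ
        = ∫ x, (2⁻¹ : ℂ) * (g x * Complex.exp (L x * Complex.I) +
            starRingEnd ℂ (g x) * Complex.exp (L x * Complex.I)) ∂μ := by
          refine integral_congr_ae (Filter.Eventually.of_forall fun x => ?_)
          simp only [Complex.re_eq_add_conj]; ring
      _ = 0 := by
          rw [integral_const_mul, integral_add (hmul L) (hmulc L), horth, hconj]; simp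
  have him := hreal (fun x => (g x).im) hgi.im fun L => by
    calc ∫ x, ((g x).im : ℂ) * Complex.exp (L x * Complex.I) ∂μ
        = ∫ x, ((2 * Complex.I)⁻¹ : ℂ) * (g x * Complex.exp (L x * Complex.I) -
            starRingEnd ℂ (g x) * Complex.exp (L x * Complex.I)) ∂μ := by
          refine integral_congr_ae (Filter.Eventually.of_forall fun x => ?_)
          simp only [Complex.im_eq_sub_conj]; ring
      _ = 0 := by
          rw [integral_const_mul, integral_sub (hmul L) (hmulc L), horth, hconj]; simp
  rw [Lp.eq_zero_iff_ae_eq_zero]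
  filter_upwards [hre, him] with x h1 h2
  exact Complex.ext h1 h2

/-! ### Variances of combinations of characters -/

/-- The variance of an element of complex `L²` over a probability measure. -/
noncomputable def lpVar {E : Type*} [NormedAddCommGroup E] [NormedSpace ℝ E]
    [SecondCountableTopology E] [MeasurableSpace E] [BorelSpace E]
    (μ : Measure E) [IsFiniteMeasure μ] (f : Lp ℂ 2 μ) : ℝ :=
  ‖f‖ ^ 2 - ‖inner ℂ (charLp μ 0) f‖ ^ 2

/-- Expanding Var(L' - L) in the Gaussian characteristic function leaves the covariance as the only
coupling term. -/
theorem ProbabilityTheory.IsGaussian.charFunDual_sub {E : Type*} [NormedAddCommGroup E] [NormedSpace ℝ E]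
    [CompleteSpace E] [MeasurableSpace E] [BorelSpace E]
    {μ : Measure E}
    [IsGaussian μ]
    (L L' : StrongDual ℝ E) :
    charFunDual μ (L' - L) = starRingEnd ℂ (charFunDual μ L) * charFunDual μ L' *
      Real.exp cov[L, L'; μ] := by
  have hL := IsGaussian.memLp_dual μ L 2 (by simp)
  have hL' := IsGaussian.memLp_dual μ L' 2 (by simp)
  have hvar : Var[(L' - L : StrongDual ℝ E); μ] =
      Var[L'; μ] - 2 * cov[L, L'; μ] + Var[L; μ] := by
    rw [covariance_comm, ← variance_sub hL' hL]
    rfl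
  have hmean : ∫ x, (((L' - L) x : ℝ) : ℂ) ∂μ = ∫ x, (L' x : ℂ) ∂μ - ∫ x, (L x : ℂ) ∂μ := by
    simp only [integral_complex_ofReal, ← Complex.ofReal_sub]
    exact congrArg _ (integral_sub (hL'.integrable (by norm_num)) (hL.integrable (by norm_num)))
  rw [IsGaussian.charFunDual_eq, IsGaussian.charFunDual_eq, IsGaussian.charFunDual_eq, hvar, hmean,
    ← Complex.exp_conj, ← Complex.exp_add, Complex.ofReal_exp, ← Complex.exp_add]
  congr 1
  simp only [integral_complex_ofReal, map_sub, map_mul, map_div₀, Complex.conj_ofReal,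
    Complex.conj_I, Complex.ofReal_add, Complex.ofReal_sub, Complex.ofReal_mul, map_ofNat,
    Complex.ofReal_ofNat]
  ring

theorem variance_sum_smul_dual {E : Type*} [NormedAddCommGroup E] [NormedSpace ℝ E]
    [MeasurableSpace E] [BorelSpace E]
    {μ : Measure E} [IsGaussian μ] {ι : Type*} [Fintype ι]
    (L : ι → StrongDual ℝ E) (x : ι → ℝ) :
    Var[(∑ k, x k • L k : StrongDual ℝ E); μ] =
      ∑ k, ∑ l, x k * (cov[L k, L l; μ] * x l) := by
  have hL (k : ι) : MemLp (x k • L k : E → ℝ) 2 μ :=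
    (IsGaussian.memLp_dual μ (L k) 2 (by simp)).const_smul _
  have h : ((∑ k, x k • L k : StrongDual ℝ E) : E → ℝ) = ∑ k, (x k • L k : E → ℝ) := by
    ext v
    simp
  rw [h, variance_sum hL]
  refine Finset.sum_congr rfl fun k _ => Finset.sum_congr rfl fun l _ => ?_
  rw [covariance_smul_left, covariance_smul_right]
  ring

section
variable {E : Type*} [NormedAddCommGroup E] [NormedSpace ℝ E]
    [SecondCountableTopology E] [MeasurableSpace E] [BorelSpace E]
    {μ : Measure E}

theorem continuous_lpVar [IsFiniteMeasure μ] : Continuous (lpVar μ) := by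
  unfold lpVar
  fun_prop

theorem inner_charLp_charLp [IsFiniteMeasure μ] (L L' : StrongDual ℝ E) :
    inner ℂ (charLp μ L) (charLp μ L') = charFunDual μ (L' - L) := by
  rw [L2.inner_def, charFunDual_apply]
  refine integral_congr_ae ?_
  filter_upwards [coeFn_charLp (μ := μ) L, coeFn_charLp (μ := μ) L'] with x h h'
  rw [h, h']
  simp [← Complex.exp_conj, ← Complex.exp_add, sub_mul]
  ring_nf

/-- The Gram matrix of characters involves exp(cov); removing the squared mean, an inner product
with the constant `charLp μ 0`, turns this into exp(cov) - 1. -/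
theorem lpVar_sum_smul_charLp [CompleteSpace E] [IsGaussian μ] {ι : Type*} [Fintype ι] (a : ι → ℂ)
    (L : ι → StrongDual ℝ E) :
    lpVar μ (∑ k, a k • charLp μ (L k)) =
      (∑ k, ∑ l, starRingEnd ℂ (a k * charFunDual μ (L k)) * (a l * charFunDual μ (L l)) *
        ((Real.exp cov[L k, L l; μ] - 1 : ℝ) : ℂ)).re := by
  have h1 : (‖∑ k, a k • charLp μ (L k)‖ : ℂ) ^ 2 =
      ∑ k, ∑ l, starRingEnd ℂ (a k * charFunDual μ (L k)) * (a l * charFunDual μ (L l)) *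
        (Real.exp cov[L k, L l; μ] : ℂ) := by
    refine (inner_self_eq_norm_sq_to_K (𝕜 := ℂ) (E := Lp ℂ 2 μ) _).symm.trans ?_
    rw [sum_inner]
    refine Finset.sum_congr rfl fun k _ => ?_
    rw [inner_sum]
    refine Finset.sum_congr rfl fun l _ => ?_
    rw [inner_smul_left, inner_smul_right, inner_charLp_charLp, IsGaussian.charFunDual_sub, map_mul]
    ring
  have h2 : (‖inner ℂ (charLp μ 0) (∑ k, a k • charLp μ (L k))‖ : ℂ) ^ 2 =
      ∑ k, ∑ l, starRingEnd ℂ (a k * charFunDual μ (L k)) * (a l * charFunDual μ (L l)) := by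
    have h : inner ℂ (charLp μ 0) (∑ k, a k • charLp μ (L k)) =
        ∑ k, a k * charFunDual μ (L k) := by
      rw [inner_sum]
      refine Finset.sum_congr rfl fun k _ => ?_
      rw [inner_smul_right, inner_charLp_charLp, sub_zero]
    rw [h, ← Complex.conj_mul', map_sum, Finset.sum_mul_sum]
  have h3 : ((lpVar μ (∑ k, a k • charLp μ (L k)) : ℝ) : ℂ) =
      ∑ k, ∑ l, starRingEnd ℂ (a k * charFunDual μ (L k)) * (a l * charFunDual μ (L l)) *
        ((Real.exp cov[L k, L l; μ] - 1 : ℝ) : ℂ) := by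
    rw [lpVar, Complex.ofReal_sub, Complex.ofReal_pow, Complex.ofReal_pow, h1, h2]
    simp only [← Finset.sum_sub_distrib, Complex.ofReal_sub, Complex.ofReal_one, mul_sub, mul_one]
  rw [← h3, Complex.ofReal_re]

/-- The variance of a real square integrable function is that of its class in complex `L²`. -/
theorem lpVar_toLp_ofReal [IsProbabilityMeasure μ] {f : E → ℝ} (hf : MemLp f 2 μ)
    (hfc : MemLp (fun x => (f x : ℂ)) 2 μ) :
    lpVar μ (hfc.toLp _) = Var[f; μ] := by
  have h1 : ‖hfc.toLp _‖ ^ 2 = ∫ x, f x ^ 2 ∂μ := by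
    have h : ((‖hfc.toLp _‖ : ℝ) : ℂ) ^ 2 =
        ((∫ x, f x ^ 2 ∂μ : ℝ) : ℂ) := by
      refine (inner_self_eq_norm_sq_to_K (𝕜 := ℂ) (E := Lp ℂ 2 μ) _).symm.trans ?_
      rw [L2.inner_def, ← integral_complex_ofReal]
      refine integral_congr_ae ?_
      filter_upwards [hfc.coeFn_toLp] with x hx
      rw [hx]
      simp only [inner_self_eq_norm_sq_to_K, Complex.norm_real, Real.norm_eq_abs]
      exact (Complex.ofReal_pow _ _).symm.trans (congrArg Complex.ofReal (sq_abs (f x)))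
    exact_mod_cast h
  have h2 : inner ℂ (charLp μ 0) (hfc.toLp _) =
      ((∫ x, f x ∂μ : ℝ) : ℂ) := by
    rw [L2.inner_def, ← integral_complex_ofReal]
    refine integral_congr_ae ?_
    filter_upwards [hfc.coeFn_toLp, coeFn_charLp (μ := μ) 0] with x hx h0
    rw [hx, h0]
    simp
  rw [lpVar, h1, h2, variance_eq_sub hf]
  simp

theorem compMeasurePreserving_charLp {F : Type*} [NormedAddCommGroup F] [NormedSpace ℝ F]
    [SecondCountableTopology F] [MeasurableSpace F] [BorelSpace F]
    {μ : Measure E} {ν : Measure F} [IsFiniteMeasure μ]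
    [IsFiniteMeasure ν] (T : E →L[ℝ] F) (hT : MeasurePreserving T μ ν) (L : StrongDual ℝ F) :
    Lp.compMeasurePreservingₗᵢ ℂ T hT (charLp ν L) = charLp μ (L.comp T) := by
  refine Lp.ext ?_
  have h : Lp.compMeasurePreservingₗᵢ ℂ T hT (charLp ν L) =ᵐ[μ] charLp ν L ∘ T :=
    Lp.coeFn_compMeasurePreserving _ hT
  filter_upwards [h, hT.quasiMeasurePreserving.ae (coeFn_charLp (μ := ν) L),
    coeFn_charLp (μ := μ) (L.comp T)] with x h1 h2 h3
  rw [h1, h3, Function.comp_apply, h2]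
  rfl

end

/-! ### From linear forms to square integrable functions -/

section
variable {E F : Type*} [NormedAddCommGroup E] [NormedSpace ℝ E] [CompleteSpace E]
    [SecondCountableTopology E] [MeasurableSpace E] [BorelSpace E]
    [NormedAddCommGroup F] [NormedSpace ℝ F] [CompleteSpace F]
    [SecondCountableTopology F] [MeasurableSpace F] [BorelSpace F]

/-- If the variance inequality `c * (Var L₁ + Var L₂) ≤ Var (L₁ + L₂)` holds for linear forms of
the two components of a Gaussian vector, then it holds for finite combinations of characters. -/
theorem lpVar_add_ge_of_sum {P : Measure (E × F)} [IsGaussian P] {c : ℝ}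
    (hc : ∀ (L₁ : StrongDual ℝ E) (L₂ : StrongDual ℝ F),
      c * (Var[L₁.comp (.fst ℝ E F); P] + Var[L₂.comp (.snd ℝ E F); P]) ≤
        Var[(L₁.comp (.fst ℝ E F) + L₂.comp (.snd ℝ E F) : StrongDual ℝ (E × F)); P])
    {ι κ : Type*} [Fintype ι] [Fintype κ]
    (a : ι → ℂ) (b : κ → ℂ) (L : ι → StrongDual ℝ E) (M : κ → StrongDual ℝ F) :
    c * (lpVar P (∑ k, a k • charLp P ((L k).comp (.fst ℝ E F))) +
        lpVar P (∑ k, b k • charLp P ((M k).comp (.snd ℝ E F)))) ≤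
      lpVar P (∑ k, a k • charLp P ((L k).comp (.fst ℝ E F)) +
        ∑ k, b k • charLp P ((M k).comp (.snd ℝ E F))) := by
  set N : ι ⊕ κ → StrongDual ℝ (E × F) :=
    Sum.elim (fun k => (L k).comp (.fst ℝ E F)) (fun k => (M k).comp (.snd ℝ E F)) with hN
  set A : Matrix (ι ⊕ κ) (ι ⊕ κ) ℝ := Matrix.of fun k l => cov[N k, N l; P] with hAdef
  -- The block-diagonal part of `A`: its quadratic form is the sum of the two separate variances.
  set B : Matrix (ι ⊕ κ) (ι ⊕ κ) ℝ :=
    Matrix.of fun k l => if k.isLeft = l.isLeft then A k l else 0 with hBdef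
  have hAsymm : A.IsHermitian := by
    ext k l
    simp [hAdef, covariance_comm]
  have hBsymm : B.IsHermitian := by
    ext k l
    have := hAsymm.apply k l
    simp only [star_trivial] at this
    simp [hBdef, this, eq_comm]
  have hA : A.PosSemidef := by
    refine Matrix.PosSemidef.of_dotProduct_mulVec_nonneg hAsymm fun x => ?_
    refine (variance_nonneg (∑ k, x k • N k : StrongDual ℝ (E × F)) P).trans_eq ?_
    rw [variance_sum_smul_dual]
    simp only [dotProduct, Matrix.mulVec, Finset.mul_sum, hAdef, star_trivial, Matrix.of_apply]
  have hAB : (A - c • B).PosSemidef := by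
    refine Matrix.PosSemidef.of_dotProduct_mulVec_nonneg (hAsymm.sub (hBsymm.smul ?_)) fun x => ?_
    · simp [IsSelfAdjoint]
    have h := hc (∑ k, x (.inl k) • L k) (∑ k, x (.inr k) • M k)
    have h1 : (∑ k, x (.inl k) • L k).comp (.fst ℝ E F) = ∑ k, x (.inl k) • N (.inl k) := by
      ext v <;> simp [hN]
    have h2 : (∑ k, x (.inr k) • M k).comp (.snd ℝ E F) = ∑ k, x (.inr k) • N (.inr k) := by
      ext v <;> simp [hN]
    rw [h1, h2, ← Fintype.sum_sum_type (fun k => x k • N k), variance_sum_smul_dual,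
      variance_sum_smul_dual, variance_sum_smul_dual, ← sub_nonneg] at h
    refine h.trans_eq ?_
    simp only [dotProduct, Matrix.mulVec, Finset.mul_sum, Matrix.sub_apply, Fintype.sum_sum_type,
      mul_add, Finset.sum_add_distrib, hBdef, hAdef, Matrix.smul_apply, Matrix.of_apply, sub_mul,
      mul_sub, Finset.sum_sub_distrib, Sum.isLeft_inl, Sum.isLeft_inr, star_trivial, smul_eq_mul]
    simp
    ring_nf
  have hexp := (posSemidef_map_exp_sub_smul hA (fun k l => by
    by_cases h : k.isLeft = l.isLeft <;> simp [hBdef, h]) hAB).re_sum_nonneg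
      fun k => Sum.elim a b k * charFunDual P (N k)
  have htot : ∑ k, a k • charLp P ((L k).comp (.fst ℝ E F)) +
        ∑ k, b k • charLp P ((M k).comp (.snd ℝ E F)) =
      ∑ k, Sum.elim a b k • charLp P (N k) := by
    simp [hN, Fintype.sum_sum_type]
  rw [htot, lpVar_sum_smul_charLp, lpVar_sum_smul_charLp, lpVar_sum_smul_charLp, ← sub_nonneg]
  refine hexp.trans_eq ?_
  rw [← Complex.add_re, ← Complex.re_ofReal_mul, ← Complex.sub_re]
  congr 1
  simp only [Fintype.sum_sum_type, Finset.mul_sum, Matrix.sub_apply,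
      mul_add, Finset.sum_add_distrib, hBdef, hAdef, Matrix.smul_apply, Matrix.of_apply,
      Matrix.map_apply, Sum.elim_inl, Sum.elim_inr, hN, Complex.ofReal_sub,
      mul_sub, Finset.sum_sub_distrib, Sum.isLeft_inl, Sum.isLeft_inr, smul_eq_mul]
  simp [mul_left_comm]
  ring_nf

/-- If the variance inequality `c * (Var L₁ + Var L₂) ≤ Var (L₁ + L₂)` holds for linear forms of
the two components of a Gaussian vector, then it holds for all square integrable functions. -/
theorem variance_add_ge_of_isGaussian {P : Measure (E × F)} [IsGaussian P] {c : ℝ}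
    (hc : ∀ (L₁ : StrongDual ℝ E) (L₂ : StrongDual ℝ F),
      c * (Var[L₁.comp (.fst ℝ E F); P] + Var[L₂.comp (.snd ℝ E F); P]) ≤
        Var[(L₁.comp (.fst ℝ E F) + L₂.comp (.snd ℝ E F) : StrongDual ℝ (E × F)); P])
    {f : E → ℝ} {g : F → ℝ} (hf : MemLp f 2 (P.map Prod.fst)) (hg : MemLp g 2 (P.map Prod.snd)) :
    c * (Var[fun x => f x.1; P] + Var[fun x => g x.2; P]) ≤ Var[fun x => f x.1 + g x.2; P] := by
  have hfst : MeasurePreserving (ContinuousLinearMap.fst ℝ E F) P (P.map Prod.fst) :=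
    ⟨measurable_fst, rfl⟩
  have hsnd : MeasurePreserving (ContinuousLinearMap.snd ℝ E F) P (P.map Prod.snd) :=
    ⟨measurable_snd, rfl⟩
  have := Measure.isProbabilityMeasure_map (μ := P) (measurable_fst (α := E) (β := F)).aemeasurable
  have := Measure.isProbabilityMeasure_map (μ := P) (measurable_snd (α := E) (β := F)).aemeasurable
  -- Both sides are continuous in the pair, since composition with a projection is an L² isometry,
  -- so the dense span of characters suffices.
  have key : ∀ p : Lp ℂ 2 (P.map Prod.fst) × Lp ℂ 2 (P.map Prod.snd),
      c * (lpVar P (Lp.compMeasurePreservingₗᵢ ℂ _ hfst p.1) +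
        lpVar P (Lp.compMeasurePreservingₗᵢ ℂ _ hsnd p.2)) ≤
      lpVar P (Lp.compMeasurePreservingₗᵢ ℂ _ hfst p.1 +
        Lp.compMeasurePreservingₗᵢ ℂ _ hsnd p.2) := by
    have hd := (Submodule.dense_iff_topologicalClosure_eq_top.2
      (span_charLp_topologicalClosure (P.map Prod.fst))).prod
      (Submodule.dense_iff_topologicalClosure_eq_top.2
        (span_charLp_topologicalClosure (P.map Prod.snd)))
    refine hd.induction ?_ (isClosed_le (α := ℝ) ?_ ?_)
    · rintro ⟨u, v⟩ ⟨hu, hv⟩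
      obtain ⟨a, rfl⟩ := Finsupp.mem_span_range_iff_exists_finsupp.1 hu
      obtain ⟨b, rfl⟩ := Finsupp.mem_span_range_iff_exists_finsupp.1 hv
      have h := lpVar_add_ge_of_sum hc (fun k : a.support => a k) (fun k : b.support => b k)
        (fun k => k) (fun k => k)
      rw [Finset.sum_coe_sort a.support fun L =>
          a L • charLp P (L.comp (ContinuousLinearMap.fst ℝ E F)),
        Finset.sum_coe_sort b.support fun L =>
          b L • charLp P (L.comp (ContinuousLinearMap.snd ℝ E F))] at h
      simp only [Finsupp.sum, map_sum, map_smul]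
      simpa only [← compMeasurePreserving_charLp _ hfst, ← compMeasurePreserving_charLp _ hsnd]
        using h
    · have := continuous_lpVar (μ := P)
      fun_prop
    · have := continuous_lpVar (μ := P)
      fun_prop
  have hfc : MemLp (fun x => (f x : ℂ)) 2 (P.map Prod.fst) := hf.ofReal
  have hgc : MemLp (fun x => (g x : ℂ)) 2 (P.map Prod.snd) := hg.ofReal
  have h := key (hfc.toLp _, hgc.toLp _)
  have hf' : MemLp (fun x : E × F => f x.1) 2 P := hf.comp_measurePreserving hfst
  have hg' : MemLp (fun x : E × F => g x.2) 2 P := hg.comp_measurePreserving hsnd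
  have hfc' : MemLp (fun x : E × F => (f x.1 : ℂ)) 2 P := hf'.ofReal
  have hgc' : MemLp (fun x : E × F => (g x.2 : ℂ)) 2 P := hg'.ofReal
  have hfg : MemLp (fun x : E × F => f x.1 + g x.2) 2 P := hf'.add hg'
  have hfgc : MemLp (fun x : E × F => ((f x.1 + g x.2 : ℝ) : ℂ)) 2 P := hfg.ofReal
  rw [← lpVar_toLp_ofReal hf' hfc', ← lpVar_toLp_ofReal hg' hgc', ← lpVar_toLp_ofReal hfg hfgc]
  refine h.trans_eq (congrArg _ ?_)
  refine (hfc'.toLp_add hgc').symm.trans ?_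
  congr 1
  ext x
  simp

end

/-! ### Comparing couplings with the same marginals -/

theorem variance_add_le_two_mul {Ω : Type*} [MeasurableSpace Ω] {μ : Measure Ω}
    [IsProbabilityMeasure μ] {X Y : Ω → ℝ} (hX : MemLp X 2 μ) (hY : MemLp Y 2 μ) :
    Var[X + Y; μ] ≤ 2 * (Var[X; μ] + Var[Y; μ]) := by
  have h1 := variance_add hX hY
  have h2 := variance_sub hX hY
  have h3 := variance_nonneg (X - Y) μ
  linarith

section
variable {E F : Type*} [MeasurableSpace E] [MeasurableSpace F]

/-- Comparison of second moments of additive functions under two couplings of the same marginals. -/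
theorem integral_sq_add_le_of_variance_add_ge {P Q : Measure (E × F)}
    [IsProbabilityMeasure P] [IsProbabilityMeasure Q]
    (h₁ : P.map Prod.fst = Q.map Prod.fst) (h₂ : P.map Prod.snd = Q.map Prod.snd)
    {c : ℝ} (hc0 : 0 ≤ c) (hc1 : c ≤ 1) {f : E → ℝ} {g : F → ℝ}
    (hf : MemLp f 2 (P.map Prod.fst)) (hg : MemLp g 2 (P.map Prod.snd))
    (hvar : c * (Var[fun x => f x.1; P] + Var[fun x => g x.2; P]) ≤
      Var[fun x => f x.1 + g x.2; P]) :
    c * ∫ x, (f x.1 + g x.2) ^ 2 ∂Q ≤ 2 * ∫ x, (f x.1 + g x.2) ^ 2 ∂P := by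
  have hfP : MemLp (fun x : E × F => f x.1) 2 P := hf.comp_of_map measurable_fst.aemeasurable
  have hgP : MemLp (fun x : E × F => g x.2) 2 P := hg.comp_of_map measurable_snd.aemeasurable
  have hfQ : MemLp (fun x : E × F => f x.1) 2 Q :=
    (h₁ ▸ hf).comp_of_map measurable_fst.aemeasurable
  have hgQ : MemLp (fun x : E × F => g x.2) 2 Q :=
    (h₂ ▸ hg).comp_of_map measurable_snd.aemeasurable
  have hVf : Var[fun x => f x.1; Q] = Var[fun x => f x.1; P] := by
    have hP := variance_map (μ := P) hf.1.aemeasurable measurable_fst.aemeasurable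
    have hQ := variance_map (μ := Q) (h₁ ▸ hf).1.aemeasurable measurable_fst.aemeasurable
    exact hQ.symm.trans (by rw [← h₁]; exact hP)
  have hVg : Var[fun x => g x.2; Q] = Var[fun x => g x.2; P] := by
    have hP := variance_map (μ := P) hg.1.aemeasurable measurable_snd.aemeasurable
    have hQ := variance_map (μ := Q) (h₂ ▸ hg).1.aemeasurable measurable_snd.aemeasurable
    exact hQ.symm.trans (by rw [← h₂]; exact hP)
  have hEf : ∫ x, f x.1 ∂Q = ∫ x, f x.1 ∂P := by
    rw [← integral_map measurable_fst.aemeasurable hf.1,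
      ← integral_map measurable_fst.aemeasurable (h₁ ▸ hf).1, h₁]
  have hEg : ∫ x, g x.2 ∂Q = ∫ x, g x.2 ∂P := by
    rw [← integral_map measurable_snd.aemeasurable hg.1,
      ← integral_map measurable_snd.aemeasurable (h₂ ▸ hg).1, h₂]
  have hEP : ∫ x, (f x.1 + g x.2) ∂P = ∫ x, f x.1 ∂P + ∫ x, g x.2 ∂P :=
    integral_add (hfP.integrable (by norm_num)) (hgP.integrable (by norm_num))
  have hEQ : ∫ x, (f x.1 + g x.2) ∂Q = ∫ x, f x.1 ∂P + ∫ x, g x.2 ∂P := by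
    rw [← hEf, ← hEg]
    exact integral_add (hfQ.integrable (by norm_num)) (hgQ.integrable (by norm_num))
  have hP := variance_eq_sub (hfP.add hgP)
  have hQ := variance_eq_sub (hfQ.add hgQ)
  have hQ2 := variance_add_le_two_mul hfQ hgQ
  simp only [Pi.add_def, Pi.pow_apply] at hP hQ hQ2
  rw [hEP] at hP
  rw [hEQ] at hQ
  rw [hVf, hVg] at hQ2
  -- The square of the common mean enters with factor c on the left and 2 on the right.
  have hm := sq_nonneg (∫ x, f x.1 ∂P + ∫ x, g x.2 ∂P)
  nlinarith [mul_le_mul_of_nonneg_left hQ2 hc0, mul_le_mul_of_nonneg_right hc1 hm]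

end

/-! ### Second moment matrices and the smallest eigenvalue -/

theorem dotProduct_secondMomentMatrix_mulVec {Ω ι : Type*} [MeasurableSpace Ω] [Fintype ι]
    {μ : Measure Ω} {X : Ω → ι → ℝ} (hX : ∀ i, MemLp (fun ω => X ω i) 2 μ) (z : ι → ℝ) :
    z ⬝ᵥ (secondMomentMatrix μ X).mulVec z = ∫ ω, (∑ i, z i * X ω i) ^ 2 ∂μ := by
  have hint (i j : ι) : Integrable (fun ω => z i * X ω i * (z j * X ω j)) μ :=
    ((hX i).const_mul (z i)).integrable_mul ((hX j).const_mul (z j))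
  simp only [sq, Finset.sum_mul_sum]
  rw [integral_finsetSum _ fun i _ => integrable_finsetSum _ fun j _ => hint i j]
  simp only [dotProduct, Matrix.mulVec, Finset.mul_sum]
  refine Finset.sum_congr rfl fun i _ => ?_
  rw [integral_finsetSum _ fun j _ => hint i j]
  refine Finset.sum_congr rfl fun j _ => ?_
  rw [secondMomentMatrix, Matrix.of_apply, ← integral_mul_const, ← integral_const_mul]
  refine integral_congr_ae (Filter.Eventually.of_forall fun ω => ?_)
  simp only
  ring

theorem isHermitian_secondMomentMatrix {Ω ι : Type*} [MeasurableSpace Ω] (μ : Measure Ω)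
    (X : Ω → ι → ℝ) : (secondMomentMatrix μ X).IsHermitian := by
  ext i j
  simp [secondMomentMatrix, mul_comm]

theorem Matrix.IsHermitian.posSemidef_sub_lambdaMin {ι : Type*} [Fintype ι] [DecidableEq ι]
    {A : Matrix ι ι ℝ} (hA : A.IsHermitian) : (A - lambdaMin A • (1 : Matrix ι ι ℝ)).PosSemidef := by
  rw [Matrix.posSemidef_iff_isHermitian_and_spectrum_nonneg]
  refine ⟨hA.sub (by simp [Matrix.IsHermitian]), ?_⟩
  -- Finiteness makes the `sInf` a genuine lower bound of the spectrum.
  have hfin : (spectrum ℝ A).Finite := by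
    rw [hA.spectrum_real_eq_range_eigenvalues]
    exact Set.finite_range _
  rw [← Algebra.algebraMap_eq_smul_one, ← spectrum.sub_singleton_eq]
  rintro _ ⟨a, ha, b, hb, rfl⟩
  rw [Set.mem_singleton_iff] at hb
  subst hb
  exact sub_nonneg.2 (csInf_le hfin.bddBelow ha)

theorem variance_dual_eq_integral_sq {E : Type*} [NormedAddCommGroup E] [NormedSpace ℝ E]
    [CompleteSpace E] [SecondCountableTopology E] [MeasurableSpace E] [BorelSpace E]
    {μ : Measure E} [IsGaussian μ] (hμ : ∫ x, x ∂μ = 0) (L : StrongDual ℝ E) :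
    Var[L; μ] = ∫ x, L x ^ 2 ∂μ := by
  have h : ∫ x, L x ∂μ = 0 := by
    exact (L.integral_comp_comm (φ := id) IsGaussian.integrable_id).trans
      ((congrArg L hμ).trans (map_zero L))
  rw [variance_of_integral_eq_zero L.continuous.aemeasurable h]

theorem dual_euclideanSpace_apply {ι : Type*} [Fintype ι] [DecidableEq ι]
    (L : StrongDual ℝ (EuclideanSpace ℝ ι)) (x : EuclideanSpace ℝ ι) :
    L x = ∑ i, L (EuclideanSpace.single i 1) * x i := by
  conv_lhs => rw [← (EuclideanSpace.basisFun ι ℝ).sum_repr x]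
  simp [mul_comm]

theorem mainTheorem1 (d₁ d₂ : ℕ) (hd₁ : 0 < d₁) (hd₂ : 0 < d₂)
    (P Q : Measure (EuclideanSpace ℝ (Fin d₁) × EuclideanSpace ℝ (Fin d₂)))
    (hP : IsGaussian P) (hQ : IsGaussian Q)
    (hP_mean : ∫ x, x ∂P = 0) (hQ_mean : ∫ x, x ∂Q = 0)
    (hmarg₁ : P.map Prod.fst = Q.map Prod.fst)
    (hmarg₂ : P.map Prod.snd = Q.map Prod.snd)
    (hcov₁ : secondMomentMatrix P (fun x i => x.1 i) = 1)
    (hcov₂ : secondMomentMatrix P (fun x j => x.2 j) = 1) :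
    restrictedErrorRatio P Q (additiveClass P) ≤
      2 / ENNReal.ofReal (lambdaMin (secondMomentMatrix P concatCoords)) := by
  set c := lambdaMin (secondMomentMatrix P concatCoords)
  rcases le_or_gt c 0 with hc0 | hc0
  · rw [ENNReal.ofReal_of_nonpos hc0, ENNReal.div_zero two_ne_zero]
    exact le_top
  have hX₁ (i : Fin d₁) : MemLp (fun x : EuclideanSpace ℝ (Fin d₁) × EuclideanSpace ℝ (Fin d₂) =>
      x.1 i) 2 P :=
    IsGaussian.memLp_dual P ((EuclideanSpace.proj i).comp (.fst ℝ _ _)) 2 (by simp)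
  have hX₂ (j : Fin d₂) : MemLp (fun x : EuclideanSpace ℝ (Fin d₁) × EuclideanSpace ℝ (Fin d₂) =>
      x.2 j) 2 P :=
    IsGaussian.memLp_dual P ((EuclideanSpace.proj j).comp (.snd ℝ _ _)) 2 (by simp)
  have hX (k : Fin d₁ ⊕ Fin d₂) : MemLp (fun x => concatCoords x k) 2 P := by
    cases k
    · exact hX₁ _
    · exact hX₂ _
  have hpsd : (secondMomentMatrix P concatCoords - c • 1).PosSemidef :=
    (isHermitian_secondMomentMatrix P concatCoords).posSemidef_sub_lambdaMin
  -- A diagonal entry of Σ_P - c I is 1 - c; one exists because `d₁` is positive.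
  have hc1 : c ≤ 1 := by
    have h := hpsd.diag_nonneg (i := .inl ⟨0, hd₁⟩)
    have h1 : secondMomentMatrix P concatCoords (.inl ⟨0, hd₁⟩) (.inl ⟨0, hd₁⟩) = 1 := by
      have := congrFun (congrFun hcov₁ ⟨0, hd₁⟩) ⟨0, hd₁⟩
      rwa [Matrix.one_apply_eq] at this
    rw [Matrix.sub_apply, h1] at h
    simpa using h
  have hlin (L₁ : StrongDual ℝ (EuclideanSpace ℝ (Fin d₁)))
      (L₂ : StrongDual ℝ (EuclideanSpace ℝ (Fin d₂))) :
      c * (Var[L₁.comp (.fst ℝ _ _); P] + Var[L₂.comp (.snd ℝ _ _); P]) ≤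
        Var[(L₁.comp (.fst ℝ _ _) + L₂.comp (.snd ℝ _ _) : StrongDual ℝ
          (EuclideanSpace ℝ (Fin d₁) × EuclideanSpace ℝ (Fin d₂))); P] := by
    have h₁ := dotProduct_secondMomentMatrix_mulVec hX₁ fun i => L₁ (EuclideanSpace.single i 1)
    have h₂ := dotProduct_secondMomentMatrix_mulVec hX₂ fun i => L₂ (EuclideanSpace.single i 1)
    have h := dotProduct_secondMomentMatrix_mulVec hX (Sum.elim
      (fun i => L₁ (EuclideanSpace.single i 1)) fun i => L₂ (EuclideanSpace.single i 1))
    have h0 := hpsd.dotProduct_mulVec_nonneg (Sum.elim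
      (fun i => L₁ (EuclideanSpace.single i 1)) fun i => L₂ (EuclideanSpace.single i 1))
    -- The identity marginal covariances turn c |z|² into c (Var L₁ + Var L₂).
    rw [star_trivial, Matrix.sub_mulVec, dotProduct_sub, h, Matrix.smul_mulVec, Matrix.one_mulVec,
      dotProduct_smul, sumElim_dotProduct_sumElim] at h0
    rw [hcov₁, Matrix.one_mulVec] at h₁
    rw [hcov₂, Matrix.one_mulVec] at h₂
    rw [h₁, h₂] at h0
    simp only [← dual_euclideanSpace_apply, Fintype.sum_sum_type, Sum.elim_inl, Sum.elim_inr,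
      concatCoords] at h0
    rw [variance_dual_eq_integral_sq hP_mean, variance_dual_eq_integral_sq hP_mean,
      variance_dual_eq_integral_sq hP_mean]
    exact sub_nonneg.1 h0
  refine iSup₂_le fun f hf => iSup₂_le fun g hg => ?_
  obtain ⟨f₁, f₂, hf₁, hf₂, rfl⟩ := hf
  obtain ⟨g₁, g₂, hg₁, hg₂, rfl⟩ := hg
  have hh₁ := hf₁.sub hg₁
  have hh₂ := hf₂.sub hg₂
  have key := integral_sq_add_le_of_variance_add_ge hmarg₁ hmarg₂ hc0.le hc1 hh₁ hh₂
    (variance_add_ge_of_isGaussian hlin hh₁ hh₂)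
  have hsum (x : EuclideanSpace ℝ (Fin d₁) × EuclideanSpace ℝ (Fin d₂)) :
      f₁ x.1 + f₂ x.2 - (g₁ x.1 + g₂ x.2) = (f₁ - g₁) x.1 + (f₂ - g₂) x.2 := by
    simp only [Pi.sub_apply]
    ring
  have hLP : MemLp (fun x : EuclideanSpace ℝ (Fin d₁) × EuclideanSpace ℝ (Fin d₂) =>
      (f₁ - g₁) x.1 + (f₂ - g₂) x.2) 2 P :=
    (hh₁.comp_of_map measurable_fst.aemeasurable).add
      (hh₂.comp_of_map measurable_snd.aemeasurable)
  have hLQ : MemLp (fun x : EuclideanSpace ℝ (Fin d₁) × EuclideanSpace ℝ (Fin d₂) =>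
      (f₁ - g₁) x.1 + (f₂ - g₂) x.2) 2 Q :=
    ((hmarg₁ ▸ hh₁).comp_of_map measurable_fst.aemeasurable).add
      ((hmarg₂ ▸ hh₂).comp_of_map measurable_snd.aemeasurable)
  simp only [hsum]
  rw [← ofReal_integral_eq_lintegral_ofReal hLP.integrable_sq
      (Filter.Eventually.of_forall fun x => sq_nonneg _),
    ← ofReal_integral_eq_lintegral_ofReal hLQ.integrable_sq
      (Filter.Eventually.of_forall fun x => sq_nonneg _)]
  refine ENNReal.div_le_of_le_mul ?_
  have h2 : 2 / ENNReal.ofReal c = ENNReal.ofReal (2 / c) := by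
    rw [ENNReal.ofReal_div_of_pos hc0, ENNReal.ofReal_ofNat]
  rw [h2, ← ENNReal.ofReal_mul (by positivity)]
  refine ENNReal.ofReal_le_ofReal ?_
  rw [div_mul_eq_mul_div, le_div_iff₀ hc0, mul_comm]
  exact key
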